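/- Let $P=(X,\prec)$ be a finite partially ordered set with $|X|=n>2$ elements. A linear extension of a poset $Q=(Y,\prec)$ with $m$ elements is a bijection $f:Y\to\{1,\dots,m\}$ such that $u\prec v$ implies $f(u)<f(v)$. Fix an element $a\in X$ and an integer $k$ with $1\le k\le n-2$. For an induced subposet $Q$ of $P$ containing $a$, let $e_k(Q)$ denote the number of linear extensions $f$ of $Q$ with $f(a)=k$, and let $P-x$, $P-x-y$ denote the induced subposets of $P$ on $X\setminus\{x\}$ and $X\setminus\{x,y\}$. Then, for all distinct minimal elements $x,y$ of the induced subposet of $P$ on $X\setminus\{a\}$, $$e_k(P)\, e_k(P-x-y) \ \le \ 2\, e_k(P-x)\, e_k(P-y).$$ -/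

import Mathlib

/-- A linear extension of a finite poset `α` with `n` elements: a bijection
`f : α → {1, …, n}` such that `x < y` implies `f x < f y`. -/
def LinExt (α : Type*) [PartialOrder α] : Type _ :=
  {f : α ≃ Set.Icc (1 : ℕ) (Nat.card α) // StrictMono f}

/-- The number `e_k` of linear extensions `f` of the poset `α` with `f a = k`. -/
noncomputable def eLinExt {α : Type*} [PartialOrder α] (a : α) (k : ℕ) : ℕ :=
  Nat.card {f : LinExt α // (f.1 a : ℕ) = k}

/-! A linear extension with f(a) = k is built by peeling X \ {a}: remove a maximal element n - k
times, then a minimal one k - 1 times. As a stays in place, an element above a may not leave as a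
minimal one, nor one below a as a maximal one; such moves get weight 0. Replacing the zeros by t > 0
makes the counts positive, and t tends to 0 at the end.

Let F count the later removals, and let N count them preceded by one or two steps of weights c.
`pairForm` is a symmetric form Q on vectors supported on the extremal elements of Y, with
off-diagonal entries F(Y - x - y) and a diagonal recording what becomes extremal once x is gone. The
vector h = `extWeight` satisfies Q(h, h) = N(Y) and Q(h, e_x) = N(Y - x) for extremal x. Q has at
most one positive direction (`isHyperbolic_removalCount`), and reverse Cauchy–Schwarz for h and a
combination of e_x and e_y gives the bound (`removalCount_mul_le`).

Hyperbolicity is proved by induction on the number of steps: `pullback_extWeight` bounds Q on Y by a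
weighted sum of the forms on the sets Y - z, and the spectral lemma
`dotProduct_mulVec_nonpos_of_pullback` turns the inductive reverse Cauchy–Schwarz inequalities into
hyperbolicity on Y. -/

open Finset

/-! ### A spectral criterion for one positive direction -/

section LinearAlgebra
open Matrix

theorem exists_orthonormal_diagonalization {ι : Type*} [Fintype ι] [DecidableEq ι]
    (S : Matrix ι ι ℝ) (hS : S.IsSymm) :
    ∃ (ev : ι → ℝ) (u : ι → ι → ℝ), (∀ k, S *ᵥ u k = ev k • u k) ∧ (∀ k, u k ⬝ᵥ u k = 1) ∧
      ∀ x, x ⬝ᵥ S *ᵥ x = ∑ k, ev k * (u k ⬝ᵥ x) ^ 2 := by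
  have hH : S.IsHermitian := by
    rw [Matrix.IsHermitian, Matrix.conjTranspose_eq_transpose_of_trivial]
    exact hS
  have hu : ∀ k, S *ᵥ (hH.eigenvectorBasis k).ofLp
      = hH.eigenvalues k • (hH.eigenvectorBasis k).ofLp := hH.mulVec_eigenvectorBasis
  refine ⟨hH.eigenvalues, fun k => (hH.eigenvectorBasis k).ofLp, hu, fun k => ?_, fun x => ?_⟩
  · have h1 := hH.eigenvectorBasis.orthonormal.1 k
    have h2 := real_inner_self_eq_norm_sq (hH.eigenvectorBasis k)
    rw [h1, EuclideanSpace.inner_eq_star_dotProduct] at h2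
    simpa using h2
  · have h := hH.eigenvectorBasis.sum_inner_mul_inner (WithLp.toLp 2 x) (WithLp.toLp 2 (S *ᵥ x))
    rw [EuclideanSpace.inner_eq_star_dotProduct] at h
    simp only [EuclideanSpace.inner_eq_star_dotProduct, star_trivial] at h
    rw [dotProduct_comm, ← h]
    refine Finset.sum_congr rfl fun k _ => ?_
    rw [dotProduct_comm (S *ᵥ x), dotProduct_mulVec, ← mulVec_transpose, hS.eq, hu k,
      smul_dotProduct, smul_eq_mul]
    ring

/-- Rescale A so that h becomes an eigenvector of eigenvalue 1. The pullback bound says λ ≤ λ² for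
every eigenvalue, so a positive one is at least 1; a Dirichlet form then forces its eigenvector to
be proportional to h. No Perron–Frobenius theorem is needed, and diagonal entries of any sign are
allowed. -/
theorem dotProduct_mulVec_nonpos_of_pullback {ι : Type*} [Fintype ι]
    (A : Matrix ι ι ℝ) (hA : A.IsSymm) (hpos : ∀ i j, i ≠ j → 0 < A i j) (h : ι → ℝ)
    (hh : ∀ i, 0 < h i) (hr : ∀ i, 0 < (A *ᵥ h) i)
    (hpull : ∀ w, w ⬝ᵥ A *ᵥ w ≤ ∑ i, h i * ((A *ᵥ w) i ^ 2 / (A *ᵥ h) i))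
    (w : ι → ℝ) (hw : h ⬝ᵥ A *ᵥ w = 0) : w ⬝ᵥ A *ᵥ w ≤ 0 := by
  classical
  -- With D = diag((Ah)_i / h_i), this is the diagonal of D^{1/2}, and S below is D^{-1/2} A
  -- D^{-1/2}.
  set sd : ι → ℝ := fun i => √((A *ᵥ h) i / h i) with hsd
  have sdpos : ∀ i, 0 < sd i := fun i => Real.sqrt_pos.2 (div_pos (hr i) (hh i))
  have sdne : ∀ i, sd i ≠ 0 := fun i => (sdpos i).ne'
  have sdsq : ∀ i, sd i ^ 2 = (A *ᵥ h) i / h i := fun i =>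
    Real.sq_sqrt (div_pos (hr i) (hh i)).le
  let S : Matrix ι ι ℝ := Matrix.of fun i j => A i j / (sd i * sd j)
  have hS : S.IsSymm := by
    ext i j
    simp only [S, transpose_apply, of_apply, hA.apply i j, mul_comm]
  have hSA : ∀ x i, (S *ᵥ x) i = (A *ᵥ fun j => x j / sd j) i / sd i := by
    intro x i
    simp only [mulVec, dotProduct, S, of_apply, Finset.sum_div]
    refine Finset.sum_congr rfl fun j _ => ?_
    field_simp [sdne i, sdne j]
  obtain ⟨ev, u, hu, hu1, hq⟩ := exists_orthonormal_diagonalization S hS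
  have key : w ⬝ᵥ A *ᵥ w = ∑ k, ev k * (u k ⬝ᵥ fun i => sd i * w i) ^ 2 := by
    rw [← hq]
    simp only [dotProduct, hSA]
    refine Finset.sum_congr rfl fun i _ => ?_
    have : (fun j => sd j * w j / sd j) = w := by
      ext j; field_simp [sdne j]
    rw [this]
    field_simp [sdne i]
  rw [key]
  refine Finset.sum_nonpos fun k _ => ?_
  rcases le_or_gt (ev k) 0 with hk | hk
  · exact mul_nonpos_of_nonpos_of_nonneg hk (sq_nonneg _)
  set v : ι → ℝ := fun i => u k i / sd i with hv
  have huv : ∀ i, u k i = sd i * v i := fun i => by simp only [hv]; field_simp [sdne i]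
  have hAv : ∀ i, (A *ᵥ v) i = ev k * sd i ^ 2 * v i := by
    intro i
    have h1 := congrFun (hu k) i
    rw [hSA, div_eq_iff (sdne i)] at h1
    rw [h1, Pi.smul_apply, smul_eq_mul, huv i]
    ring
  have hnorm : ∑ i, sd i ^ 2 * v i ^ 2 = 1 := by
    rw [← hu1 k]
    refine Finset.sum_congr rfl fun i _ => ?_
    rw [huv i]; ring
  have hvAv : v ⬝ᵥ A *ᵥ v = ev k := by
    rw [← mul_one (ev k), ← hnorm, Finset.mul_sum]
    refine Finset.sum_congr rfl fun i _ => ?_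
    rw [hAv i]; ring
  have hge : ev k ≤ ev k ^ 2 := by
    have h1 := hpull v
    rw [hvAv] at h1
    refine h1.trans (le_of_eq ?_)
    rw [← mul_one (ev k ^ 2), ← hnorm, Finset.mul_sum]
    refine Finset.sum_congr rfl fun i _ => ?_
    have h2 : (A *ᵥ h) i = sd i ^ 2 * h i := by rw [sdsq]; field_simp [(hh i).ne']
    rw [hAv i, h2]
    field_simp [sdne i, (hh i).ne']
  have hone : 1 ≤ ev k := by nlinarith
  -- The left side is nonnegative, as its diagonal terms vanish, so `ev k` ≤ 1. Together with `hone`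
  -- every term is zero and v / h is constant.
  have hsum : ∑ i, ∑ j, A i j * h i * h j * (v i / h i - v j / h j) ^ 2 = 2 - 2 * ev k := by
    have e1 : ∑ i, ∑ j, A i j * h j * (v i ^ 2 / h i) = 1 := by
      rw [← hnorm]
      refine Finset.sum_congr rfl fun i _ => ?_
      rw [← Finset.sum_mul, sdsq]
      simp only [mulVec, dotProduct]
      ring
    have e2 : ∑ i, ∑ j, A i j * h i * (v j ^ 2 / h j) = 1 := by
      rw [← e1, Finset.sum_comm]
      refine Finset.sum_congr rfl fun i _ => Finset.sum_congr rfl fun j _ => ?_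
      rw [hA.apply i j]
    have e3 : ∑ i, ∑ j, v i * (A i j * v j) = ev k := by
      rw [← hvAv]
      simp only [mulVec, dotProduct, Finset.mul_sum]
    have e4 : (2 : ℝ) - 2 * ev k = 1 + 1 - 2 * ev k := by ring
    rw [e4]
    nth_rewrite 1 [← e1]
    rw [← e2, ← e3, Finset.mul_sum, ← Finset.sum_add_distrib, ← Finset.sum_sub_distrib]
    refine Finset.sum_congr rfl fun i _ => ?_
    rw [Finset.mul_sum, ← Finset.sum_add_distrib, ← Finset.sum_sub_distrib]
    refine Finset.sum_congr rfl fun j _ => ?_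
    field_simp [(hh i).ne', (hh j).ne']
    ring
  have hterm : ∀ i j, 0 ≤ A i j * h i * h j * (v i / h i - v j / h j) ^ 2 := by
    intro i j
    rcases eq_or_ne i j with rfl | hij
    · simp
    · have := hpos i j hij
      have := hh i
      have := hh j
      positivity
  have hconst : ∀ i j, v i / h i = v j / h j := by
    intro i j
    rcases eq_or_ne i j with rfl | hij
    · rfl
    have h0 : A i j * h i * h j * (v i / h i - v j / h j) ^ 2 ≤ 0 := by
      calc _ ≤ ∑ j', A i j' * h i * h j' * (v i / h i - v j' / h j') ^ 2 :=
            Finset.single_le_sum (f := fun j' => A i j' * h i * h j' * (v i / h i - v j' / h j') ^ 2)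
              (fun j' _ => hterm i j') (Finset.mem_univ j)
        _ ≤ _ := Finset.single_le_sum
              (f := fun i' => ∑ j', A i' j' * h i' * h j' * (v i' / h i' - v j' / h j') ^ 2)
              (fun i' _ => Finset.sum_nonneg fun j' _ => hterm i' j') (Finset.mem_univ i)
        _ ≤ 0 := by rw [hsum]; linarith
    have hc : 0 < A i j * h i * h j := mul_pos (mul_pos (hpos i j hij) (hh i)) (hh j)
    have h1 : (v i / h i - v j / h j) ^ 2 ≤ 0 := by
      by_contra hcon
      exact absurd h0 (not_le.2 (mul_pos hc (not_le.1 hcon)))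
    exact sub_eq_zero.1 (pow_eq_zero_iff two_ne_zero |>.1 (le_antisymm h1 (sq_nonneg _)))
  have hzero : (u k ⬝ᵥ fun i => sd i * w i) = 0 := by
    rcases isEmpty_or_nonempty ι with he | ⟨⟨i0⟩⟩
    · simp [dotProduct]
    have h1 : h ⬝ᵥ A *ᵥ w = ∑ i, (A *ᵥ h) i * w i := by
      rw [dotProduct_mulVec, ← mulVec_transpose, hA.eq]; rfl
    rw [h1] at hw
    calc (u k ⬝ᵥ fun i => sd i * w i) = ∑ i, v i0 / h i0 * ((A *ᵥ h) i * w i) := by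
          refine Finset.sum_congr rfl fun i _ => ?_
          rw [huv i, hconst i0 i]
          have h2 : (A *ᵥ h) i = sd i ^ 2 * h i := by rw [sdsq]; field_simp [(hh i).ne']
          rw [h2]
          field_simp [(hh i).ne']
      _ = 0 := by rw [← Finset.mul_sum, hw, mul_zero]
  rw [hzero]
  simp

/-- If the inequality failed, the form would be positive definite on the plane spanned by f and w,
which meets the hyperplane `h ⬝ᵥ A *ᵥ w = 0`. -/
theorem reverse_cauchy_schwarz_of_nonpos {ι : Type*} [Fintype ι] (A : Matrix ι ι ℝ)
    (hA : A.IsSymm) (h : ι → ℝ) (hneg : ∀ w, h ⬝ᵥ A *ᵥ w = 0 → w ⬝ᵥ A *ᵥ w ≤ 0)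
    (f w : ι → ℝ) (hf : 0 ≤ f ⬝ᵥ A *ᵥ f) :
    (f ⬝ᵥ A *ᵥ f) * (w ⬝ᵥ A *ᵥ w) ≤ (f ⬝ᵥ A *ᵥ w) ^ 2 := by
  have hsymm : w ⬝ᵥ A *ᵥ f = f ⬝ᵥ A *ᵥ w := by
    rw [dotProduct_mulVec, ← mulVec_transpose, hA.eq, dotProduct_comm]
  by_contra! hlt
  have hfpos : 0 < f ⬝ᵥ A *ᵥ f := by
    rcases hf.lt_or_eq with h0 | h0
    · exact h0
    · rw [← h0, zero_mul] at hlt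
      exact absurd hlt (not_lt.2 (sq_nonneg _))
  have hcomb : ∀ a b : ℝ, a * (h ⬝ᵥ A *ᵥ f) + b * (h ⬝ᵥ A *ᵥ w) = 0 →
      a ^ 2 * (f ⬝ᵥ A *ᵥ f) + 2 * a * b * (f ⬝ᵥ A *ᵥ w) + b ^ 2 * (w ⬝ᵥ A *ᵥ w) ≤ 0 := by
    intro a b hab
    have h1 := hneg (a • f + b • w) (by
      simpa [mulVec_add, mulVec_smul, dotProduct_add, dotProduct_smul] using hab)
    simp only [mulVec_add, mulVec_smul, dotProduct_add, dotProduct_smul, add_dotProduct,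
      smul_dotProduct, smul_eq_mul, hsymm] at h1
    linarith
  have h1 := hcomb (h ⬝ᵥ A *ᵥ w) (-(h ⬝ᵥ A *ᵥ f)) (by ring)
  have h2 : h ⬝ᵥ A *ᵥ f ≠ 0 := fun h0 => absurd (hneg f h0) (not_le.2 hfpos)
  generalize h ⬝ᵥ A *ᵥ f = p at *
  generalize h ⬝ᵥ A *ᵥ w = q at *
  generalize f ⬝ᵥ A *ᵥ f = a at *
  generalize f ⬝ᵥ A *ᵥ w = b at *
  generalize w ⬝ᵥ A *ᵥ w = c at *
  have h3 : 0 < p ^ 2 * (a * c - b ^ 2) := mul_pos (by positivity) (by linarith)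
  nlinarith [sq_nonneg (q * a - p * b)]

end LinearAlgebra

/-! ### Peeling extremal elements and the associated bilinear form -/

section Recursion

variable {X : Type*}

open Classical in
/-- The elements of `Y` that are `r`-below `y`. -/
noncomputable def dn (r : X → X → Prop) (Y : Finset X) (y : X) : Finset X := Y.filter (r · y)

open Classical in
/-- The weight `k` restricted to the `r`-minimal elements of `Y`. -/
noncomputable def minWeight (r : X → X → Prop) (k : X → ℝ) (Y : Finset X) (x : X) : ℝ :=
  if dn r Y x = ∅ then k x else 0

/-- The combination with coefficients `c` of the weights `k` on the minimal and `l` on the maximal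
elements of `Y`. -/
noncomputable def extWeight (r : X → X → Prop) (k l : X → ℝ) (c : ℝ × ℝ) (Y : Finset X)
    (x : X) : ℝ :=
  c.1 * minWeight r k Y x + c.2 * minWeight (flip r) l Y x

/-- `x` is minimal or maximal in `Y`. -/
def IsExt (r : X → X → Prop) (Y : Finset X) (x : X) : Prop :=
  dn r Y x = ∅ ∨ dn (flip r) Y x = ∅

/-- `w` vanishes on the elements of `Y` that are not extremal. -/
def ExtSupported (r : X → X → Prop) (Y : Finset X) (w : X → ℝ) : Prop :=
  ∀ x ∈ Y, ¬ IsExt r Y x → w x = 0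

variable {r : X → X → Prop} {Y : Finset X}

theorem mem_dn {x y : X} : x ∈ dn r Y y ↔ x ∈ Y ∧ r x y := by simp [dn]

theorem dn_eq_empty {y : X} : dn r Y y = ∅ ↔ ∀ x ∈ Y, ¬ r x y := by
  simp [Finset.eq_empty_iff_forall_notMem, mem_dn]

theorem dn_eq_singleton {y z : X} :
    dn r Y y = {z} ↔ z ∈ Y ∧ r z y ∧ ∀ x ∈ Y, r x y → x = z := by
  simp only [Finset.eq_singleton_iff_unique_mem, mem_dn, and_assoc, and_imp]

theorem isExt_flip {x : X} : IsExt (flip r) Y x ↔ IsExt r Y x := or_comm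

theorem extSupported_flip {w : X → ℝ} : ExtSupported (flip r) Y w ↔ ExtSupported r Y w := by
  simp only [ExtSupported, isExt_flip]

variable {k l : X → ℝ} {F : Finset X → ℝ} [DecidableEq X]

/-- The weighted number of ways of exhausting `Y` by removing extremal elements one at a time,
where the list `C` gives the weights used at the successive steps. -/
noncomputable def removalCount (r : X → X → Prop) (k l : X → ℝ) :
    List (ℝ × ℝ) → Finset X → ℝ
  | [], Y => if Y = ∅ then 1 else 0
  | c :: C, Y => ∑ x ∈ Y, extWeight r k l c Y x * removalCount r k l C (Y.erase x)

open Classical in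
/-- The coefficient with which removing `z` from `Y` passes its weight on to an element `y` that
becomes extremal. -/
noncomputable def transfer (r : X → X → Prop) (k l : X → ℝ) (Y : Finset X) (z y : X) : ℝ :=
  (if dn r Y y = {z} then k y / k z else 0) + (if dn (flip r) Y y = {z} then l y / l z else 0)

/-- The restriction of a vector indexed by the extremal elements of `Y` to `Y.erase z`. -/
noncomputable def restr (r : X → X → Prop) (k l : X → ℝ) (Y : Finset X) (z : X) (w : X → ℝ)
    (y : X) : ℝ :=
  w y + w z * transfer r k l Y z y

/-- The linear form `w ↦ ∑ x ∈ Y, w x * F (Y.erase x)`. -/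
noncomputable def linForm (F : Finset X → ℝ) (Y : Finset X) (w : X → ℝ) : ℝ :=
  ∑ x ∈ Y, w x * F (Y.erase x)

/-- The bilinear form associated with a count `F`. -/
noncomputable def pairForm (r : X → X → Prop) (k l : X → ℝ) (F : Finset X → ℝ) (Y : Finset X)
    (w w' : X → ℝ) : ℝ :=
  ∑ x ∈ Y, w x * linForm F (Y.erase x) (restr r k l Y x w')

theorem dn_erase (x y : X) : dn r (Y.erase x) y = (dn r Y y).erase x := by
  ext z; simp [mem_dn, and_assoc]

theorem dn_eq_pair {y z x : X} :
    dn r Y y = {x, z} ↔ (x ∈ Y ∧ r x y) ∧ (z ∈ Y ∧ r z y) ∧ ∀ v ∈ Y, r v y → v = x ∨ v = z := by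
  constructor
  · intro h
    refine ⟨mem_dn.1 (h ▸ by simp), mem_dn.1 (h ▸ by simp), fun v hv hr => ?_⟩
    have : v ∈ dn r Y y := mem_dn.2 ⟨hv, hr⟩
    simpa [h] using this
  · rintro ⟨h1, h2, h3⟩
    ext v
    simp only [mem_dn, Finset.mem_insert, Finset.mem_singleton]
    constructor
    · exact fun h => h3 v h.1 h.2
    · rintro (rfl | rfl) <;> assumption

theorem transfer_flip (z y : X) : transfer (flip r) l k Y z y = transfer r k l Y z y := by
  unfold transfer
  rw [add_comm]
  rfl

theorem restr_flip (z : X) (w : X → ℝ) : restr (flip r) l k Y z w = restr r k l Y z w := by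
  funext y; simp only [restr, transfer_flip]

/-- The ratios in `transfer` are chosen for this: an element made minimal by removing x inherits
exactly its own weight. Such an x is not maximal, so the two kinds of weight do not interfere. -/
theorem restr_minWeight (hk : ∀ x, k x ≠ 0) {x y : X}
    (he : IsExt r Y x) (hy : y ∈ Y.erase x) :
    restr r k l Y x (minWeight r k Y) y = minWeight r k (Y.erase x) y := by
  have hyY := Finset.mem_of_mem_erase hy
  have hyx := Finset.ne_of_mem_erase hy
  unfold restr
  by_cases hmin : dn r Y x = ∅
  · have hup : dn (flip r) Y y ≠ {x} := fun h =>
      dn_eq_empty.1 hmin y hyY (dn_eq_singleton.1 h).2.1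
    have hd : dn r (Y.erase x) y = ∅ ↔ dn r Y y = ∅ ∨ dn r Y y = {x} := by
      rw [dn_erase, Finset.erase_eq_empty_iff]
    by_cases h1 : dn r Y y = {x}
    · have h2 := hk x
      simp only [minWeight, transfer, hd, hmin, hup, h1, if_true, if_false, or_true,
        Finset.singleton_ne_empty]
      field_simp
      ring
    · simp [minWeight, transfer, hd, hmin, hup, h1]
  · have hmax : dn (flip r) Y x = ∅ := he.resolve_left hmin
    have hd : dn r (Y.erase x) y = dn r Y y := by
      rw [dn_erase, Finset.erase_eq_of_notMem]
      exact fun h => dn_eq_empty.1 hmax y hyY (mem_dn.1 h).2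
    simp [minWeight, hd, hmin]

theorem restr_extWeight (hk : ∀ x, k x ≠ 0) (hl : ∀ x, l x ≠ 0)
    (c : ℝ × ℝ) {x y : X} (he : IsExt r Y x) (hy : y ∈ Y.erase x) :
    restr r k l Y x (extWeight r k l c Y) y = extWeight r k l c (Y.erase x) y := by
  have h1 := restr_minWeight (l := l) hk he hy
  have h2 := restr_minWeight (r := flip r) (l := k) hl (isExt_flip.2 he) hy
  rw [restr_flip] at h2
  unfold restr at h1 h2
  simp only [restr, extWeight]
  rw [← h1, ← h2]
  ring

theorem linForm_congr {w w' : X → ℝ} (h : ∀ x ∈ Y, w x = w' x) :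
    linForm F Y w = linForm F Y w' :=
  Finset.sum_congr rfl fun x hx => by rw [h x hx]

theorem removalCount_cons (c : ℝ × ℝ) (C : List (ℝ × ℝ)) :
    removalCount r k l (c :: C) Y = linForm (removalCount r k l C) Y (extWeight r k l c Y) := rfl

/-- Expanding one further step turns the linear form of the longer count into Q(·, h) for the
shorter one, since h restricts to the extremal weights of each Y - x. -/
theorem linForm_removalCount_cons (hk : ∀ x, k x ≠ 0) (hl : ∀ x, l x ≠ 0)
    (c : ℝ × ℝ) (C : List (ℝ × ℝ)) {w : X → ℝ} (hw : ExtSupported r Y w) :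
    linForm (removalCount r k l (c :: C)) Y w
      = pairForm r k l (removalCount r k l C) Y w (extWeight r k l c Y) := by
  refine Finset.sum_congr rfl fun x hx => ?_
  by_cases he : IsExt r Y x
  · rw [removalCount_cons]
    congr 1
    exact linForm_congr fun y hy => (restr_extWeight hk hl c he hy).symm
  · rw [hw x hx he, zero_mul, zero_mul]

open Classical in
/-- The matrix of `pairForm`. -/
noncomputable def pairMatrix (r : X → X → Prop) (k l : X → ℝ) (F : Finset X → ℝ) (Y : Finset X)
    (x y : X) : ℝ :=
  if x = y then ∑ v ∈ Y.erase x, transfer r k l Y x v * F ((Y.erase x).erase v)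
  else F ((Y.erase x).erase y)

theorem pairMatrix_comm (x y : X) : pairMatrix r k l F Y x y = pairMatrix r k l F Y y x := by
  by_cases h : x = y
  · rw [h]
  · simp only [pairMatrix, h, Ne.symm h, if_false, Finset.erase_right_comm]

theorem linForm_restr (w : X → ℝ) {x : X} (hx : x ∈ Y) :
    linForm F (Y.erase x) (restr r k l Y x w) = ∑ y ∈ Y, pairMatrix r k l F Y x y * w y := by
  rw [← Finset.add_sum_erase _ _ hx]
  simp only [linForm, restr, add_mul, Finset.sum_add_distrib]
  rw [add_comm]
  congr 1
  · simp only [pairMatrix, if_true, Finset.sum_mul]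
    exact Finset.sum_congr rfl fun y _ => by ring
  · refine Finset.sum_congr rfl fun y hy => ?_
    simp only [pairMatrix, (Finset.ne_of_mem_erase hy).symm, if_false]
    ring

theorem pairForm_eq_sum (w w' : X → ℝ) :
    pairForm r k l F Y w w' = ∑ x ∈ Y, ∑ y ∈ Y, w x * pairMatrix r k l F Y x y * w' y := by
  refine Finset.sum_congr rfl fun x hx => ?_
  rw [linForm_restr w' hx, Finset.mul_sum]
  exact Finset.sum_congr rfl fun y _ => by ring

theorem pairForm_comm (w w' : X → ℝ) :
    pairForm r k l F Y w w' = pairForm r k l F Y w' w := by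
  rw [pairForm_eq_sum, pairForm_eq_sum, Finset.sum_comm]
  refine Finset.sum_congr rfl fun x _ => Finset.sum_congr rfl fun y _ => ?_
  rw [pairMatrix_comm]; ring

theorem extSupported_restr {w : X → ℝ} {z : X} (hw : ExtSupported r Y w) :
    ExtSupported r (Y.erase z) (restr r k l Y z w) := by
  intro y hy hne
  have hyY := Finset.mem_of_mem_erase hy
  simp only [IsExt, dn_erase, Finset.erase_eq_empty_iff, not_or] at hne
  have h1 : w y = 0 := hw y hyY (by
    rintro (h | h)
    · exact hne.1.1 h
    · exact hne.2.1 h)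
  simp [restr, transfer, h1, hne]

end Recursion

/-! ### The pullback inequality -/

section Pullback

variable {X : Type*} [DecidableEq X] {r : X → X → Prop} {k l : X → ℝ} {F : Finset X → ℝ}
  {Y : Finset X}

open Classical in
-- Restrictions commute except at a y whose only lower elements are x and z: there y becomes minimal
-- at the second removal, so it inherits from whichever of the two leaves last.
theorem restr_restr_sub {x z y : X} (hx : x ∈ Y) (hz : z ∈ Y) (hy : y ∈ Y)
    (hyx : y ≠ x) (hyz : y ≠ z) (hxz : x ≠ z) (hmin : dn r Y z = ∅) (he : IsExt r Y x)
    (w : X → ℝ) :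
    restr r k l (Y.erase z) x (restr r k l Y z w) y
        - restr r k l (Y.erase x) z (restr r k l Y x w) y
      = if dn r Y y = {x, z} then k y * (w x / k x - w z / k z) else 0 := by
  have hz' := dn_eq_empty.1 hmin
  have a1 : ∀ v ∈ Y, dn (flip r) Y v ≠ {z} := fun v hv h => hz' v hv (dn_eq_singleton.1 h).2.1
  have hup : dn (flip r) (Y.erase z) y = dn (flip r) Y y := by
    rw [dn_erase, Finset.erase_eq_of_notMem]
    exact fun h => hz' y hy (mem_dn.1 h).2
  have hupz : dn (flip r) (Y.erase x) y ≠ {z} := fun h => by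
    rw [dn_eq_singleton] at h
    exact hz' y hy h.2.1
  have hd : ∀ u v, u ∈ Y → v ∈ Y → u ≠ v →
      (dn r (Y.erase v) y = {u} ↔ dn r Y y = {u} ∨ dn r Y y = {u, v}) := by
    intro u v hu hv huv
    rw [dn_erase]
    constructor
    · intro h
      by_cases hvm : v ∈ dn r Y y
      · right
        rw [← Finset.insert_erase hvm, h, Finset.pair_comm]
      · left
        rwa [Finset.erase_eq_of_notMem hvm] at h
    · rintro (h | h)
      · rw [h, Finset.erase_eq_of_notMem]
        simpa using huv.symm
      · rw [h, Finset.pair_comm, Finset.erase_insert]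
        simpa using huv.symm
  have hnot : ∀ u v, u ≠ v → ¬ (dn r Y y = {u} ∧ dn r Y y = {u, v}) := by
    rintro u v huv ⟨h1, h2⟩
    rw [h1] at h2
    have : v ∈ ({u} : Finset X) := by rw [h2]; simp
    exact huv (Finset.mem_singleton.1 this).symm
  have hc : transfer r k l (Y.erase z) x y
      = transfer r k l Y x y + if dn r Y y = {x, z} then k y / k x else 0 := by
    have h1 := hd x z hx hz hxz
    have h2 := hnot x z hxz
    simp only [transfer, hup, h1]
    by_cases p : dn r Y y = {x}
    · have q : dn r Y y ≠ {x, z} := fun q => h2 ⟨p, q⟩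
      rw [if_pos (Or.inl p), if_pos p, if_neg q]
      ring
    · by_cases q : dn r Y y = {x, z}
      · rw [if_pos (Or.inr q), if_neg p, if_pos q]
        ring
      · rw [if_neg (not_or.2 ⟨p, q⟩), if_neg p, if_neg q]
        ring
  have hdz : transfer r k l (Y.erase x) z y
      = transfer r k l Y z y + if dn r Y y = {x, z} then k y / k z else 0 := by
    have h1 := hd z x hz hx hxz.symm
    have h2 := hnot z x hxz.symm
    rw [Finset.pair_comm z x] at h1 h2
    simp only [transfer, hupz, h1, a1 y hy]
    by_cases p : dn r Y y = {z}
    · have q : dn r Y y ≠ {x, z} := fun q => h2 ⟨p, q⟩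
      rw [if_pos (Or.inl p), if_pos p, if_neg q]
      ring
    · by_cases q : dn r Y y = {x, z}
      · rw [if_pos (Or.inr q), if_neg p, if_pos q]
        ring
      · rw [if_neg (not_or.2 ⟨p, q⟩), if_neg p, if_neg q]
        ring
  -- A double transfer through x cannot occur: x is extremal, so if removing z makes it minimal then
  -- it was already maximal, with nothing above it to receive weight.
  have ha : transfer r k l Y z x * transfer r k l (Y.erase z) x y = 0 := by
    by_cases h : dn r Y x = {z}
    · have hmax : dn (flip r) Y x = ∅ := he.resolve_left (by simp [h])
      have h1 : dn r (Y.erase z) y ≠ {x} := fun h1 =>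
        dn_eq_empty.1 hmax y hy (dn_eq_singleton.1 h1).2.1
      have h2 : dn (flip r) Y y ≠ {x} := fun h2 =>
        hyz ((dn_eq_singleton.1 h).2.2 y hy (dn_eq_singleton.1 h2).2.1)
      simp [transfer, hup, h1, h2]
    · simp [transfer, h, a1 x hx]
  have hb : transfer r k l Y x z * transfer r k l (Y.erase x) z y = 0 := by
    by_cases h : dn (flip r) Y z = {x}
    · have h1 : dn r (Y.erase x) y ≠ {z} := fun h1 =>
        hyx ((dn_eq_singleton.1 h).2.2 y hy (dn_eq_singleton.1 h1).2.1)
      simp [transfer, hupz, h1]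
    · simp [transfer, h, hmin]
  have e : restr r k l (Y.erase z) x (restr r k l Y z w) y
        - restr r k l (Y.erase x) z (restr r k l Y x w) y
      = w z * transfer r k l Y z y + w x * transfer r k l (Y.erase z) x y
        - w x * transfer r k l Y x y - w z * transfer r k l (Y.erase x) z y
        + w z * (transfer r k l Y z x * transfer r k l (Y.erase z) x y)
        - w x * (transfer r k l Y x z * transfer r k l (Y.erase x) z y) := by
    simp only [restr]; ring
  rw [e, ha, hb, hc, hdz]
  split_ifs <;> ring

theorem sum_sum_erase_comm (Y : Finset X) (f : X → X → ℝ) :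
    ∑ x ∈ Y, ∑ z ∈ Y.erase x, f x z = ∑ x ∈ Y, ∑ z ∈ Y.erase x, f z x :=
  Finset.sum_comm' (by
    intro x y
    simp only [Finset.mem_erase]
    tauto)

/-- The right side minus the left is half a sum of squares of w x / k x - w z / k z, with
nonnegative coefficients carried by the elements lying above exactly x and z. -/
theorem pullback_minWeight (hk : ∀ x, 0 < k x) (hF : ∀ S, 0 ≤ F S)
    {w : X → ℝ} (hw : ExtSupported r Y w) :
    ∑ x ∈ Y, w x * ∑ z ∈ Y.erase x, minWeight r k (Y.erase x) z
        * linForm F ((Y.erase x).erase z) (restr r k l (Y.erase x) z (restr r k l Y x w))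
      ≤ ∑ z ∈ Y, minWeight r k Y z
        * pairForm r k l F (Y.erase z) (restr r k l Y z w) (restr r k l Y z w) := by
  classical
  set G : X → X → ℝ := fun x z =>
    linForm F ((Y.erase x).erase z) (restr r k l (Y.erase x) z (restr r k l Y x w)) with hG
  set q : X → X → ℝ := fun x z => ∑ y ∈ (Y.erase x).erase z,
    (if dn r Y y = {x, z} then k y else 0) * F (((Y.erase x).erase z).erase y) with hq
  have hq0 : ∀ x z, 0 ≤ q x z := fun x z => Finset.sum_nonneg fun y _ =>
    mul_nonneg (by split_ifs <;> [exact (hk y).le; exact le_rfl]) (hF _)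
  have hqc : ∀ x z, q x z = q z x := by
    intro x z
    simp only [hq, Finset.erase_right_comm (a := x) (b := z), Finset.pair_comm x z]
  have hlhs : ∀ x ∈ Y, w x * ∑ z ∈ Y.erase x, minWeight r k (Y.erase x) z * G x z
      = ∑ z ∈ Y.erase x, (w x * minWeight r k Y z * G x z
        + w x * minWeight r k Y x * transfer r k l Y x z * G x z) := by
    intro x hx
    rw [Finset.mul_sum]
    refine Finset.sum_congr rfl fun z hz => ?_
    by_cases he : IsExt r Y x
    · rw [← restr_minWeight (l := l) (fun x => (hk x).ne') he hz, restr]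
      ring
    · rw [hw x hx he]; ring
  have hrhs : ∀ z ∈ Y, minWeight r k Y z
        * pairForm r k l F (Y.erase z) (restr r k l Y z w) (restr r k l Y z w)
      = ∑ x ∈ Y.erase z, (w x * minWeight r k Y z * G z x
        + w z * minWeight r k Y z * transfer r k l Y z x * G z x) := by
    intro z _
    rw [pairForm, Finset.mul_sum]
    refine Finset.sum_congr rfl fun x _ => ?_
    simp only [hG, restr]
    ring
  rw [Finset.sum_congr rfl hlhs, Finset.sum_congr rfl hrhs]
  simp only [Finset.sum_add_distrib]
  -- The transfer terms on the two sides agree up to the names of the summation variables.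
  refine add_le_add ?_ le_rfl
  rw [sum_sum_erase_comm, ← sub_nonneg, ← Finset.sum_sub_distrib]
  have hdiff : ∀ z ∈ Y, ∀ x ∈ Y.erase z,
      w x * minWeight r k Y z * G z x - w x * minWeight r k Y z * G x z
        = minWeight r k Y x * minWeight r k Y z * q z x
          * (w x / k x * (w x / k x - w z / k z)) := by
    intro z hz x hx
    have hxY := Finset.mem_of_mem_erase hx
    have hxz := Finset.ne_of_mem_erase hx
    by_cases hmin : dn r Y z = ∅
    swap
    · simp [minWeight, hmin]
    by_cases he : IsExt r Y x
    swap
    · simp [hw x hxY he]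
    have h1 : G z x - G x z = q z x * (w x / k x - w z / k z) := by
      simp only [hG, hq, linForm, Finset.sum_mul]
      rw [Finset.erase_right_comm (a := x) (b := z), ← Finset.sum_sub_distrib]
      refine Finset.sum_congr rfl fun y hy => ?_
      simp only [Finset.mem_erase] at hy
      rw [← sub_mul, restr_restr_sub hxY hz hy.2.2 hy.1 hy.2.1 hxz hmin he w,
        Finset.pair_comm x z]
      split_ifs <;> ring
    rw [← mul_sub, h1]
    -- If q z x is nonzero, some y lies above x, so the extremal element x must be minimal.
    by_cases hq1 : q z x = 0
    · rw [hq1]; ring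
    have hxmin : dn r Y x = ∅ := by
      obtain ⟨y, hy, hne⟩ := Finset.exists_ne_zero_of_sum_ne_zero hq1
      have h2 : dn r Y y = {z, x} := by
        by_contra h
        simp [h] at hne
      have h3 := dn_eq_pair.1 h2
      simp only [Finset.mem_erase] at hy
      exact he.resolve_right fun h => dn_eq_empty.1 h y hy.2.2 h3.2.1.2
    have h4 := (hk x).ne'
    simp only [minWeight, hxmin, hmin, if_true]
    field_simp
  have h2 : ∑ z ∈ Y, (∑ x ∈ Y.erase z, w x * minWeight r k Y z * G z x
      - ∑ x ∈ Y.erase z, w x * minWeight r k Y z * G x z)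
      = ∑ z ∈ Y, ∑ x ∈ Y.erase z, minWeight r k Y x * minWeight r k Y z * q z x
          * (w x / k x * (w x / k x - w z / k z)) := by
    refine Finset.sum_congr rfl fun z hz => ?_
    rw [← Finset.sum_sub_distrib]
    exact Finset.sum_congr rfl (hdiff z hz)
  rw [h2]
  -- Symmetrise in x and z, using that q is symmetric.
  have h3 : 2 * ∑ z ∈ Y, ∑ x ∈ Y.erase z, minWeight r k Y x * minWeight r k Y z * q z x
          * (w x / k x * (w x / k x - w z / k z))
      = ∑ z ∈ Y, ∑ x ∈ Y.erase z, minWeight r k Y x * minWeight r k Y z * q z x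
          * (w x / k x - w z / k z) ^ 2 := by
    rw [two_mul]
    nth_rewrite 1 [sum_sum_erase_comm]
    rw [← Finset.sum_add_distrib]
    refine Finset.sum_congr rfl fun z _ => ?_
    rw [← Finset.sum_add_distrib]
    refine Finset.sum_congr rfl fun x _ => ?_
    rw [hqc x z]
    ring
  have hm : ∀ x, 0 ≤ minWeight r k Y x := fun x => by
    unfold minWeight; split_ifs <;> [exact (hk x).le; exact le_rfl]
  have h4 : 0 ≤ ∑ z ∈ Y, ∑ x ∈ Y.erase z, minWeight r k Y x * minWeight r k Y z * q z x
          * (w x / k x - w z / k z) ^ 2 :=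
    Finset.sum_nonneg fun z _ => Finset.sum_nonneg fun x _ =>
      mul_nonneg (mul_nonneg (mul_nonneg (hm x) (hm z)) (hq0 z x)) (sq_nonneg _)
  linarith

end Pullback

/-! ### Hyperbolicity by induction, and the inequality for positive weights -/

section Hyperbolic

variable {X : Type*} [DecidableEq X] {r : X → X → Prop} {k l : X → ℝ} {F : Finset X → ℝ}
  {Y : Finset X}

theorem pairForm_flip (w w' : X → ℝ) :
    pairForm (flip r) l k F Y w w' = pairForm r k l F Y w w' := by
  simp only [pairForm, restr_flip]

theorem pullback_extWeight (hk : ∀ x, 0 < k x) (hl : ∀ x, 0 < l x) (hF : ∀ S, 0 ≤ F S)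
    {c : ℝ × ℝ} (hc1 : 0 ≤ c.1) (hc2 : 0 ≤ c.2) {w : X → ℝ} (hw : ExtSupported r Y w) :
    ∑ x ∈ Y, w x * ∑ z ∈ Y.erase x, extWeight r k l c (Y.erase x) z
        * linForm F ((Y.erase x).erase z) (restr r k l (Y.erase x) z (restr r k l Y x w))
      ≤ ∑ z ∈ Y, extWeight r k l c Y z
        * pairForm r k l F (Y.erase z) (restr r k l Y z w) (restr r k l Y z w) := by
  have h1 := mul_le_mul_of_nonneg_left (pullback_minWeight (l := l) hk hF hw) hc1
  have h2 := mul_le_mul_of_nonneg_left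
    (pullback_minWeight (l := k) hl hF (extSupported_flip.2 hw)) hc2
  simp only [restr_flip, pairForm_flip] at h2
  refine le_trans (le_of_eq ?_) ((add_le_add h1 h2).trans (le_of_eq ?_))
  · simp only [Finset.mul_sum, ← Finset.sum_add_distrib, extWeight]
    refine Finset.sum_congr rfl fun x _ => Finset.sum_congr rfl fun z _ => ?_
    ring
  · simp only [Finset.mul_sum, ← Finset.sum_add_distrib, extWeight]
    refine Finset.sum_congr rfl fun x _ => ?_
    ring

omit [DecidableEq X] in
theorem minWeight_nonneg (hk : ∀ x, 0 ≤ k x) (x : X) : 0 ≤ minWeight r k Y x := by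
  unfold minWeight
  split_ifs
  exacts [hk x, le_rfl]

omit [DecidableEq X] in
theorem extWeight_nonneg (hk : ∀ x, 0 ≤ k x) (hl : ∀ x, 0 ≤ l x) {c : ℝ × ℝ} (hc1 : 0 ≤ c.1)
    (hc2 : 0 ≤ c.2) (x : X) : 0 ≤ extWeight r k l c Y x :=
  add_nonneg (mul_nonneg hc1 (minWeight_nonneg hk x)) (mul_nonneg hc2 (minWeight_nonneg hl x))

omit [DecidableEq X] in
theorem extWeight_pos (hk : ∀ x, 0 < k x) (hl : ∀ x, 0 < l x) {c : ℝ × ℝ} (hc1 : 0 < c.1)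
    (hc2 : 0 < c.2) {x : X} (he : IsExt r Y x) : 0 < extWeight r k l c Y x := by
  have h1 := minWeight_nonneg (r := r) (Y := Y) (fun x => (hk x).le) x
  have h2 := minWeight_nonneg (r := flip r) (Y := Y) (fun x => (hl x).le) x
  rcases he with h | h
  · have h3 : minWeight r k Y x = k x := if_pos h
    exact add_pos_of_pos_of_nonneg (mul_pos hc1 (h3 ▸ hk x)) (mul_nonneg hc2.le h2)
  · have h3 : minWeight (flip r) l Y x = l x := if_pos h
    exact add_pos_of_nonneg_of_pos (mul_nonneg hc1.le h1) (mul_pos hc2 (h3 ▸ hl x))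

omit [DecidableEq X] in
theorem extSupported_extWeight (c : ℝ × ℝ) : ExtSupported r Y (extWeight r k l c Y) := by
  intro x _ hne
  simp only [IsExt, not_or] at hne
  simp [extWeight, minWeight, hne.1, hne.2]

theorem removalCount_nonneg (hk : ∀ x, 0 ≤ k x) (hl : ∀ x, 0 ≤ l x) (C : List (ℝ × ℝ))
    (hC : ∀ c ∈ C, 0 ≤ c.1 ∧ 0 ≤ c.2) (Y : Finset X) : 0 ≤ removalCount r k l C Y := by
  induction C generalizing Y with
  | nil => unfold removalCount; split_ifs <;> norm_num
  | cons c C ih =>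
    have hc := hC c (by simp)
    exact Finset.sum_nonneg fun x _ => mul_nonneg (extWeight_nonneg hk hl hc.1 hc.2 x)
      (ih (fun c hc => hC c (by simp [hc])) _)

theorem removalCount_pos (hmin : ∀ Y : Finset X, Y.Nonempty → ∃ x ∈ Y, dn r Y x = ∅)
    (hk : ∀ x, 0 < k x) (hl : ∀ x, 0 < l x) (C : List (ℝ × ℝ))
    (hC : ∀ c ∈ C, 0 < c.1 ∧ 0 < c.2) (Y : Finset X) (hY : #Y = C.length) :
    0 < removalCount r k l C Y := by
  induction C generalizing Y with
  | nil => simp [removalCount, Finset.card_eq_zero.1 hY]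
  | cons c C ih =>
    have hc := hC c (by simp)
    rw [List.length_cons] at hY
    obtain ⟨x, hx, hxm⟩ := hmin Y (Finset.card_pos.1 (by omega))
    refine Finset.sum_pos' (fun x _ => mul_nonneg
      (extWeight_nonneg (fun x => (hk x).le) (fun x => (hl x).le) hc.1.le hc.2.le x)
      (removalCount_nonneg (fun x => (hk x).le) (fun x => (hl x).le) C
        (fun c hc => ?_) _)) ⟨x, hx, mul_pos (extWeight_pos hk hl hc.1 hc.2 (Or.inl hxm))
        (ih (fun c hc => hC c (by simp [hc])) _ ?_)⟩
    · have := hC c (by simp [hc])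
      exact ⟨this.1.le, this.2.le⟩
    · rw [Finset.card_erase_of_mem hx, hY]
      rfl

/-- `pairForm` has at most one positive direction on the vectors supported on extremal elements. -/
def IsHyperbolic (r : X → X → Prop) (k l : X → ℝ) (F : Finset X → ℝ) (Y : Finset X) : Prop :=
  ∀ f w, ExtSupported r Y f → ExtSupported r Y w → 0 ≤ pairForm r k l F Y f f →
    pairForm r k l F Y f f * pairForm r k l F Y w w ≤ pairForm r k l F Y f w ^ 2

/-- The form is a 2 × 2 matrix with off-diagonal entries 1, so the claim is that its diagonal
product is at most 1. When u lies below v this product is (k v / k u)(l u / l v), which `hkl`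
bounds. -/
theorem isHyperbolic_nil (hmin : ∀ Y : Finset X, Y.Nonempty → ∃ x ∈ Y, dn r Y x = ∅)
    (hk : ∀ x, 0 < k x) (hl : ∀ x, 0 < l x) (hkl : ∀ x y, r x y → k y * l x ≤ k x * l y)
    (hY : #Y = 2) : IsHyperbolic r k l (removalCount r k l []) Y := by
  obtain ⟨x, y, hxy, rfl⟩ := Finset.card_eq_two.1 hY
  have hprod : transfer r k l {x, y} x y * transfer r k l {x, y} y x ≤ 1 := by
    have key : ∀ u v : X, dn r {u, v} u = ∅ →
        transfer r k l {u, v} u v * transfer r k l {u, v} v u ≤ 1 := by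
      intro u v hu
      have h1 : dn (flip r) {u, v} v ≠ {u} := fun h =>
        dn_eq_empty.1 hu v (by simp) (dn_eq_singleton.1 h).2.1
      simp only [transfer, hu, h1, if_false, (Finset.singleton_ne_empty _).symm, zero_add,
        add_zero]
      split_ifs with h2 h3
      · have hr := (dn_eq_singleton.1 h2).2.1
        rw [div_mul_div_comm, div_le_one (mul_pos (hk u) (hl v))]
        exact hkl u v hr
      all_goals simp
    obtain ⟨u, hu, hum⟩ := hmin {x, y} (by simp)
    rcases Finset.mem_insert.1 hu with rfl | hu
    · exact key _ _ hum
    · rw [Finset.mem_singleton] at hu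
      subst hu
      rw [mul_comm, Finset.pair_comm]
      rw [Finset.pair_comm] at hum
      exact key _ _ hum
  have hform : ∀ f w, pairForm r k l (removalCount r k l []) {x, y} f w
      = f x * transfer r k l {x, y} x y * w x + f x * w y + f y * w x
        + f y * transfer r k l {x, y} y x * w y := by
    intro f w
    have e1 : ({x, y} : Finset X).erase x = {y} := by
      rw [Finset.erase_insert]; simpa using hxy
    have e2 : ({x, y} : Finset X).erase y = {x} := by
      rw [Finset.pair_comm, Finset.erase_insert]; simpa using hxy.symm
    simp only [pairForm, Finset.sum_pair hxy, e1, e2, linForm, Finset.sum_singleton,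
      Finset.erase_singleton, removalCount, restr, if_true]
    ring
  intro f w _ _ _
  rw [hform, hform, hform]
  generalize transfer r k l {x, y} x y = a at *
  generalize transfer r k l {x, y} y x = b at *
  have := mul_nonneg (sub_nonneg.2 hprod) (sq_nonneg (f x * w y - f y * w x))
  linarith

theorem isHyperbolic_cons (hmin : ∀ Y : Finset X, Y.Nonempty → ∃ x ∈ Y, dn r Y x = ∅)
    (hk : ∀ x, 0 < k x) (hl : ∀ x, 0 < l x) {c : ℝ × ℝ} {C : List (ℝ × ℝ)}
    (hc : 0 < c.1 ∧ 0 < c.2) (hC : ∀ c ∈ C, 0 < c.1 ∧ 0 < c.2) (hY : #Y = C.length + 3)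
    (ih : ∀ z ∈ Y, IsHyperbolic r k l (removalCount r k l C) (Y.erase z)) :
    IsHyperbolic r k l (removalCount r k l (c :: C)) Y := by
  classical
  have hk0 : ∀ x, k x ≠ 0 := fun x => (hk x).ne'
  have hl0 : ∀ x, l x ≠ 0 := fun x => (hl x).ne'
  have hcC : ∀ d ∈ c :: C, 0 < d.1 ∧ 0 < d.2 := List.forall_mem_cons.2 ⟨hc, hC⟩
  set F := removalCount r k l (c :: C) with hF
  set E := Y.filter (IsExt r Y) with hE
  let A : Matrix E E ℝ := Matrix.of fun i j => pairMatrix r k l F Y i j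
  have hA : A.IsSymm := by
    ext i j
    exact pairMatrix_comm _ _
  have hsum : ∀ g : X → ℝ, (∀ x ∈ Y, ¬ IsExt r Y x → g x = 0) →
      ∑ i : E, g i = ∑ x ∈ Y, g x := by
    intro g hg
    rw [Finset.sum_coe_sort E g, hE, Finset.sum_filter_of_ne]
    intro x hx hne
    by_contra h
    exact hne (hg x hx h)
  have hmul : ∀ w, ExtSupported r Y w → ∀ i : E,
      A.mulVec (fun j : E => w j) i = linForm F (Y.erase i) (restr r k l Y i w) := by
    intro w hw i
    rw [linForm_restr w (Finset.mem_filter.1 i.2).1]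
    exact hsum (fun y => pairMatrix r k l F Y i y * w y) fun x hx hne => by
      rw [hw x hx hne, mul_zero]
  have hquad : ∀ f w, ExtSupported r Y f → ExtSupported r Y w →
      dotProduct (fun i : E => f i) (A.mulVec fun j : E => w j) = pairForm r k l F Y f w := by
    intro f w hf hw
    simp only [dotProduct, hmul w hw]
    exact hsum (fun x => f x * linForm F (Y.erase x) (restr r k l Y x w)) fun x hx hne => by
      rw [hf x hx hne, zero_mul]
  set h : X → ℝ := extWeight r k l c Y with hh
  have hhs : ExtSupported r Y h := extSupported_extWeight c
  have hcard : ∀ i : E, #(Y.erase i) = C.length + 2 := fun i => by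
    rw [Finset.card_erase_of_mem (Finset.mem_filter.1 i.2).1, hY]
    rfl
  -- Taking h with the same c as the first step of F makes row i of A equal to the shorter form on Y
  -- - i paired with the restriction of h, so the inductive reverse Cauchy–Schwarz inequality
  -- applies row by row.
  have hrow : ∀ (w : X → ℝ), ExtSupported r Y w → ∀ i : E,
      A.mulVec (fun j : E => w j) i = pairForm r k l (removalCount r k l C) (Y.erase i)
        (restr r k l Y i h) (restr r k l Y i w) := by
    intro w hw i
    have hi := Finset.mem_filter.1 i.2
    rw [hmul w hw, hF, linForm_removalCount_cons hk0 hl0 c C (extSupported_restr hw),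
      pairForm_comm]
    refine Finset.sum_congr rfl fun y hy => ?_
    rw [restr_extWeight hk0 hl0 c hi.2 hy]
  have hrowpos : ∀ i : E, 0 < A.mulVec (fun j : E => h j) i := by
    intro i
    have hi := Finset.mem_filter.1 i.2
    have h1 : linForm F (Y.erase i) (restr r k l Y i h)
        = removalCount r k l (c :: c :: C) (Y.erase i) := by
      rw [removalCount_cons]
      exact linForm_congr fun y hy => restr_extWeight hk0 hl0 c hi.2 hy
    rw [hmul h hhs, h1]
    exact removalCount_pos hmin hk hl _ (List.forall_mem_cons.2 ⟨hc, hcC⟩) _ (by simp [hcard])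
  have hnn : ∀ S, 0 ≤ removalCount r k l C S :=
    removalCount_nonneg (fun x => (hk x).le) (fun x => (hl x).le) C
      fun c hc => ⟨(hC c hc).1.le, (hC c hc).2.le⟩
  have main : ∀ u : E → ℝ, dotProduct (fun i : E => h i) (A.mulVec u) = 0 →
      dotProduct u (A.mulVec u) ≤ 0 := by
    refine dotProduct_mulVec_nonpos_of_pullback A hA ?_ _
      (fun i => extWeight_pos hk hl hc.1 hc.2 (Finset.mem_filter.1 i.2).2) hrowpos ?_
    · intro i j hij
      have hij' : (i : X) ≠ j := fun h => hij (Subtype.ext h)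
      have hj : (j : X) ∈ Y.erase i :=
        Finset.mem_erase.2 ⟨hij'.symm, (Finset.mem_filter.1 j.2).1⟩
      simp only [A, Matrix.of_apply, pairMatrix, hij', if_false]
      refine removalCount_pos hmin hk hl _ hcC _ ?_
      rw [Finset.card_erase_of_mem hj, hcard]
      rfl
    · intro u
      set w : X → ℝ := fun x => if hx : x ∈ E then u ⟨x, hx⟩ else 0 with hwdef
      have hwu : (fun i : E => w i) = u := by
        funext i
        simp [hwdef]
      have hw : ExtSupported r Y w := by
        intro x _ hne
        have : x ∉ E := fun hx => hne (Finset.mem_filter.1 hx).2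
        simp [hwdef, this]
      rw [← hwu, hquad w w hw hw]
      have h1 : pairForm r k l F Y w w ≤ ∑ z ∈ Y, h z
          * pairForm r k l (removalCount r k l C) (Y.erase z) (restr r k l Y z w)
            (restr r k l Y z w) := by
        refine le_trans (le_of_eq ?_) (pullback_extWeight hk hl hnn hc.1.le hc.2.le hw)
        refine Finset.sum_congr rfl fun x _ => ?_
        rw [hF, linForm_removalCount_cons hk0 hl0 c C (extSupported_restr hw), pairForm_comm]
        rfl
      refine h1.trans ?_
      rw [← hsum (fun z => h z * pairForm r k l (removalCount r k l C) (Y.erase z)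
        (restr r k l Y z w) (restr r k l Y z w)) fun x hx hne => by
          rw [hhs x hx hne, zero_mul]]
      refine Finset.sum_le_sum fun i _ => ?_
      have hi := Finset.mem_filter.1 i.2
      refine mul_le_mul_of_nonneg_left ?_ (extWeight_pos hk hl hc.1 hc.2 hi.2).le
      rw [le_div_iff₀ (hrowpos i), hrow h hhs i, hrow w hw i, mul_comm]
      refine ih i hi.1 _ _ (extSupported_restr hhs) (extSupported_restr hw) ?_
      rw [← hrow h hhs i]
      exact (hrowpos i).le
  intro f w hf hw
  rw [← hquad f f hf hf, ← hquad w w hw hw, ← hquad f w hf hw]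
  exact reverse_cauchy_schwarz_of_nonpos A hA _ main _ _

theorem isHyperbolic_removalCount
    (hmin : ∀ Y : Finset X, Y.Nonempty → ∃ x ∈ Y, dn r Y x = ∅)
    (hk : ∀ x, 0 < k x) (hl : ∀ x, 0 < l x) (hkl : ∀ x y, r x y → k y * l x ≤ k x * l y)
    (C : List (ℝ × ℝ)) (hC : ∀ c ∈ C, 0 < c.1 ∧ 0 < c.2) (Y : Finset X)
    (hY : #Y = C.length + 2) : IsHyperbolic r k l (removalCount r k l C) Y := by
  induction C generalizing Y with
  | nil => exact isHyperbolic_nil hmin hk hl hkl hY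
  | cons c C ih =>
    have hC' : ∀ c ∈ C, 0 < c.1 ∧ 0 < c.2 := fun c hc => hC c (by simp [hc])
    refine isHyperbolic_cons hmin hk hl (hC c (by simp)) hC' hY fun z hz => ih hC' _ ?_
    rw [Finset.card_erase_of_mem hz, hY]
    rfl

theorem removalCount_mul_le
    (hmin : ∀ Y : Finset X, Y.Nonempty → ∃ x ∈ Y, dn r Y x = ∅)
    (hk : ∀ x, 0 < k x) (hl : ∀ x, 0 < l x) (hkl : ∀ x y, r x y → k y * l x ≤ k x * l y)
    {c : ℝ × ℝ} (hc : 0 < c.1 ∧ 0 < c.2) {C : List (ℝ × ℝ)} (hC : ∀ c ∈ C, 0 < c.1 ∧ 0 < c.2)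
    (hY : #Y = C.length + 2) {x y : X} (hx : x ∈ Y) (hy : y ∈ Y) (hxy : x ≠ y)
    (hex : IsExt r Y x) (hey : IsExt r Y y) :
    removalCount r k l (c :: c :: C) Y * removalCount r k l C ((Y.erase x).erase y)
      ≤ 2 * removalCount r k l (c :: C) (Y.erase x) * removalCount r k l (c :: C) (Y.erase y) := by
  classical
  have hk0 : ∀ x, k x ≠ 0 := fun x => (hk x).ne'
  have hl0 : ∀ x, l x ≠ 0 := fun x => (hl x).ne'
  have hcC : ∀ d ∈ c :: C, 0 < d.1 ∧ 0 < d.2 := List.forall_mem_cons.2 ⟨hc, hC⟩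
  have hH := isHyperbolic_removalCount hmin hk hl hkl C hC Y hY
  set F := removalCount r k l C with hF
  have hnn : ∀ S, 0 ≤ F S :=
    removalCount_nonneg (fun x => (hk x).le) (fun x => (hl x).le) C
      fun c hc => ⟨(hC c hc).1.le, (hC c hc).2.le⟩
  have hp : 0 < removalCount r k l (c :: C) (Y.erase x) :=
    removalCount_pos hmin hk hl _ hcC _ (by rw [Finset.card_erase_of_mem hx, hY]; rfl)
  have hq : 0 < removalCount r k l (c :: C) (Y.erase y) :=
    removalCount_pos hmin hk hl _ hcC _ (by rw [Finset.card_erase_of_mem hy, hY]; rfl)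
  set p := removalCount r k l (c :: C) (Y.erase x) with hpdef
  set q := removalCount r k l (c :: C) (Y.erase y) with hqdef
  set h := extWeight r k l c Y with hh
  have hhs : ExtSupported r Y h := extSupported_extWeight c
  -- The crossed coefficients make both contributions to Q(h, w) equal to p * q. In Q(w, w) the
  -- off-diagonal part is 2pq F(Y - x - y), and the nonnegative diagonal is discarded; this is where
  -- the factor 2 arises.
  set w : X → ℝ := fun v => (if v = x then q else 0) + (if v = y then p else 0) with hw
  have hws : ExtSupported r Y w := by
    intro v _ hne
    have h1 : v ≠ x := fun h => hne (h ▸ hex)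
    have h2 : v ≠ y := fun h => hne (h ▸ hey)
    simp [hw, h1, h2]
  have e1 : pairForm r k l F Y h h = removalCount r k l (c :: c :: C) Y := by
    rw [removalCount_cons, linForm_removalCount_cons hk0 hl0 c C hhs]
  have e2 : pairForm r k l F Y h w = 2 * p * q := by
    rw [pairForm_comm, ← linForm_removalCount_cons hk0 hl0 c C hws]
    simp only [linForm, hw, add_mul, ite_mul, zero_mul, Finset.sum_add_distrib,
      Finset.sum_ite_eq', hx, hy, if_true, ← hpdef, ← hqdef]
    ring
  have hdiag : ∀ v, 0 ≤ pairMatrix r k l F Y v v := by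
    intro v
    simp only [pairMatrix, if_true]
    refine Finset.sum_nonneg fun u _ => mul_nonneg ?_ (hnn _)
    have := div_pos (hk u) (hk v)
    have := div_pos (hl u) (hl v)
    unfold transfer
    split_ifs <;> linarith
  have e3 : 2 * p * q * F ((Y.erase x).erase y) ≤ pairForm r k l F Y w w := by
    have hxy' : pairMatrix r k l F Y x y = F ((Y.erase x).erase y) := by
      simp [pairMatrix, hxy]
    have : pairForm r k l F Y w w = q * pairMatrix r k l F Y x x * q
        + p * pairMatrix r k l F Y y y * p + 2 * p * q * F ((Y.erase x).erase y) := by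
      rw [pairForm_eq_sum]
      simp only [hw, add_mul, mul_add, ite_mul, mul_ite, zero_mul, mul_zero,
        Finset.sum_add_distrib, Finset.sum_ite_eq', hx, hy, if_true]
      rw [pairMatrix_comm y x, hxy']
      ring
    rw [this]
    have := mul_nonneg (mul_nonneg hq.le (hdiag x)) hq.le
    have := mul_nonneg (mul_nonneg hp.le (hdiag y)) hp.le
    linarith
  have e0 : 0 ≤ removalCount r k l (c :: c :: C) Y :=
    removalCount_nonneg (fun x => (hk x).le) (fun x => (hl x).le) _
      (fun d hd => by
        have : 0 < d.1 ∧ 0 < d.2 := by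
          simp only [List.mem_cons] at hd
          rcases hd with rfl | rfl | hd
          exacts [hc, hc, hC d hd]
        exact ⟨this.1.le, this.2.le⟩) Y
  have h1 := hH h w hhs hws (e1 ▸ e0)
  rw [e1, e2] at h1
  have h2 := (mul_le_mul_of_nonneg_left e3 e0).trans h1
  have h3 : 0 < 2 * p * q := by positivity
  refine le_of_mul_le_mul_left ?_ h3
  linarith

end Hyperbolic

/-! ### Recursion for order-preserving bijections -/

section Counting

theorem continuous_removalCount {X : Type*} [DecidableEq X] (r : X → X → Prop)
    {k l : ℝ → X → ℝ} (hk : ∀ x, Continuous fun t => k t x) (hl : ∀ x, Continuous fun t => l t x)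
    (C : List (ℝ → ℝ × ℝ)) (hC : ∀ g ∈ C, Continuous g) (Y : Finset X) :
    Continuous fun t => removalCount r (k t) (l t) (C.map fun g => g t) Y := by
  have hm : ∀ (r : X → X → Prop) {k : ℝ → X → ℝ}, (∀ x, Continuous fun t => k t x) →
      ∀ (Y : Finset X) x, Continuous fun t => minWeight r (k t) Y x := by
    intro r k hk Y x
    unfold minWeight
    split_ifs
    exacts [hk x, continuous_const]
  induction C generalizing Y with
  | nil => exact continuous_const
  | cons g C ih =>
    have hg : Continuous g := hC g (by simp)
    have ih' := ih fun g hg => hC g (by simp [hg])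
    simp only [List.map_cons, removalCount, extWeight]
    refine continuous_finsetSum _ fun x _ => ((hg.fst.mul (hm r hk Y x)).add
      (hg.snd.mul (hm _ hl Y x))).mul (ih' _)

theorem removalCount_map {α X : Type*} [DecidableEq α] [DecidableEq X] (e : α ↪ X)
    (r : X → X → Prop) (k l : X → ℝ) (C : List (ℝ × ℝ)) (Y : Finset α) :
    removalCount r k l C (Y.map e)
      = removalCount (fun x y => r (e x) (e y)) (fun x => k (e x)) (fun x => l (e x)) C Y := by
  have hdn : ∀ (r : X → X → Prop) (Y : Finset α) (x : α),
      dn r (Y.map e) (e x) = ∅ ↔ dn (fun x y => r (e x) (e y)) Y x = ∅ := by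
    intro r Y x
    simp [dn_eq_empty]
  induction C generalizing Y with
  | nil => simp [removalCount]
  | cons c C ih =>
    simp only [removalCount, Finset.sum_map, ← Finset.map_erase, ih]
    refine Finset.sum_congr rfl fun x _ => ?_
    congr 1
    simp only [extWeight, minWeight, hdn]
    rfl

variable {α β : Type*} [Fintype α] [DecidableEq α] [Fintype β] [DecidableEq β]

open Classical in
/-- The monotone bijections from `S` to `P` which send `a` to `b`, extended by the value `b`. -/
noncomputable def placements (r : α → α → Prop) (s : β → β → Prop) (a : α) (b : β)
    (S : Finset α) (P : Finset β) : Finset (α → β) :=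
  Finset.univ.filter fun f => (∀ x ∉ S, f x = b) ∧ Set.BijOn f S P ∧
    (∀ x ∈ S, ∀ y ∈ S, r x y → s (f x) (f y)) ∧ f a = b

variable {r : α → α → Prop} {s : β → β → Prop} {a : α} {b : β} {S : Finset α} {P : Finset β}

theorem mem_placements {f : α → β} : f ∈ placements r s a b S P ↔
    (∀ x ∉ S, f x = b) ∧ Set.BijOn f S P ∧
    (∀ x ∈ S, ∀ y ∈ S, r x y → s (f x) (f y)) ∧ f a = b := by
  simp [placements]

theorem placements_flip : placements (flip r) (flip s) a b S P = placements r s a b S P := by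
  ext f
  simp only [mem_placements, flip]
  refine and_congr_right fun _ => and_congr_right fun _ => and_congr_left fun _ => ?_
  exact ⟨fun h x hx y hy => h y hy x hx, fun h x hx y hy => h y hy x hx⟩

open Classical in
-- Delete z together with the top position m, resetting f at z to the default b; the inverse puts z
-- back on top. Only a maximal z can sit there.
theorem card_placements_fiber (hs : ∀ c d, s c d → ¬ s d c) {m : β} (hm : m ∈ P)
    (htop : ∀ c ∈ P, c ≠ m → s c m) {z : α} (hz : z ∈ S) (hza : z ≠ a) :
    #{f ∈ placements r s a b S P | f z = m}
      = if dn (flip r) S z = ∅ then #(placements r s a b (S.erase z) (P.erase m)) else 0 := by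
  split_ifs with htz
  · refine Finset.card_nbij' (fun f => Function.update f z b) (fun g => Function.update g z m)
      ?_ ?_ ?_ ?_
    · intro f hf
      simp only [Finset.coe_filter, Set.mem_ofPred_eq, mem_placements] at hf
      obtain ⟨⟨h1, h2, h3, h4⟩, h5⟩ := hf
      have hne : ∀ x ∈ S.erase z, Function.update f z b x = f x := fun x hx =>
        Function.update_of_ne (Finset.ne_of_mem_erase hx) _ _
      beta_reduce
      refine Finset.mem_coe.2 (mem_placements.2 ⟨?_, ?_, ?_, ?_⟩)
      · intro x hx
        by_cases hxz : x = z
        · simp [hxz]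
        · rw [Function.update_of_ne hxz]
          exact h1 x fun h => hx (Finset.mem_erase.2 ⟨hxz, h⟩)
      · have h6 : Set.BijOn f (S.erase z) (P.erase m) := by
          rw [Finset.coe_erase, Finset.coe_erase, ← h5]
          exact h2.sdiff_singleton (Finset.mem_coe.2 hz)
        exact h6.congr fun x hx => (hne x hx).symm
      · intro x hx y hy hxy
        rw [hne x hx, hne y hy]
        exact h3 x (Finset.mem_of_mem_erase hx) y (Finset.mem_of_mem_erase hy) hxy
      · rwa [Function.update_of_ne hza.symm]
    · intro g hg
      obtain ⟨h1, h2, h3, h4⟩ := mem_placements.1 (Finset.mem_coe.1 hg)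
      have hne : ∀ x, x ≠ z → Function.update g z m x = g x := fun x hx =>
        Function.update_of_ne hx _ _
      simp only [Finset.coe_filter, Set.mem_ofPred_eq, mem_placements]
      refine ⟨⟨?_, ?_, ?_, ?_⟩, by simp⟩
      · intro x hx
        rw [hne x fun h => hx (h ▸ hz)]
        exact h1 x fun h => hx (Finset.mem_of_mem_erase h)
      · have h6 : Set.BijOn (Function.update g z m) (S.erase z) (P.erase m) :=
          h2.congr fun x hx => (hne x (Finset.ne_of_mem_erase hx)).symm
        have h7 := h6.insert (a := z) (by simp)
        rwa [Function.update_self, ← Finset.coe_insert, ← Finset.coe_insert,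
          Finset.insert_erase hz, Finset.insert_erase hm] at h7
      · intro x hx y hy hxy
        have hxz : x ≠ z := fun h => dn_eq_empty.1 htz y hy (h ▸ hxy)
        have hx' := Finset.mem_erase.2 ⟨hxz, hx⟩
        rw [hne x hxz]
        by_cases hyz : y = z
        · rw [hyz, Function.update_self]
          have := h2.mapsTo hx'
          exact htop _ (Finset.mem_of_mem_erase this) (Finset.ne_of_mem_erase this)
        · rw [hne y hyz]
          exact h3 x hx' y (Finset.mem_erase.2 ⟨hyz, hy⟩) hxy
      · rwa [hne a hza.symm]
    · intro f hf
      simp only [Finset.coe_filter, Set.mem_ofPred_eq] at hf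
      simp [← hf.2]
    · intro g hg
      have := (mem_placements.1 (Finset.mem_coe.1 hg)).1 z (by simp)
      simp [← this]
  · rw [Finset.card_eq_zero, Finset.filter_eq_empty_iff]
    intro f hf hfz
    obtain ⟨h1, h2, h3, h4⟩ := mem_placements.1 hf
    refine htz (dn_eq_empty.2 fun y hy hzy => ?_)
    have h5 := h3 z hz y hy hzy
    rw [hfz] at h5
    by_cases h6 : f y = m
    · rw [h6] at h5
      exact hs _ _ h5 h5
    · exact hs _ _ h5 (htop _ (h2.mapsTo hy) h6)

theorem card_placements (hs : ∀ c d, s c d → ¬ s d c) {m : β} (hm : m ∈ P) (hmb : m ≠ b)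
    (htop : ∀ c ∈ P, c ≠ m → s c m) :
    (#(placements r s a b S P) : ℝ) = ∑ z ∈ S.erase a,
      (if dn (flip r) S z = ∅ then 1 else 0)
        * (#(placements r s a b (S.erase z) (P.erase m)) : ℝ) := by
  classical
  have h1 : #(placements r s a b S P)
      = ∑ z ∈ S.erase a, #{f ∈ placements r s a b S P | f z = m} := by
    simp only [Finset.card_filter]
    rw [Finset.card_eq_sum_ones, Finset.sum_comm]
    refine Finset.sum_congr rfl fun f hf => ?_
    obtain ⟨h1, h2, h3, h4⟩ := mem_placements.1 hf
    obtain ⟨z, hz, hfz⟩ := h2.surjOn hm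
    have hza : z ≠ a := fun h => hmb (by rw [← hfz, h, h4])
    rw [Finset.sum_eq_single_of_mem z (Finset.mem_erase.2 ⟨hza, hz⟩), if_pos hfz]
    intro y hy hyz
    refine if_neg fun hfy => hyz (h2.injOn (Finset.mem_of_mem_erase hy) hz (hfy.trans hfz.symm))
  rw [h1, Nat.cast_sum]
  refine Finset.sum_congr rfl fun z hz => ?_
  rw [card_placements_fiber hs hm htop (Finset.mem_of_mem_erase hz)
    (Finset.ne_of_mem_erase hz)]
  split_ifs <;> simp

theorem card_placements_singleton (ha : a ∈ S) (hra : ¬ r a a) :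
    #(placements r s a b S {b}) = if S.erase a = ∅ then 1 else 0 := by
  split_ifs with h
  · have hS : S = {a} := by rw [← Finset.insert_erase ha, h]; rfl
    rw [Finset.card_eq_one]
    refine ⟨fun _ => b, Finset.eq_singleton_iff_unique_mem.2 ⟨?_, fun f hf => ?_⟩⟩
    · rw [mem_placements, hS]
      simp [Set.bijOn_singleton, hra]
    · obtain ⟨h1, h2, h3, h4⟩ := mem_placements.1 hf
      funext x
      by_cases hx : x ∈ S
      · exact Finset.mem_singleton.1 (h2.mapsTo hx)
      · exact h1 x hx
  · rw [Finset.card_eq_zero, Finset.eq_empty_iff_forall_notMem]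
    intro f hf
    obtain ⟨h1, h2, h3, h4⟩ := mem_placements.1 hf
    obtain ⟨z, hz⟩ := Finset.nonempty_iff_ne_empty.2 h
    have hzS := Finset.mem_of_mem_erase hz
    exact Finset.ne_of_mem_erase hz
      (h2.injOn hzS ha ((Finset.mem_singleton.1 (h2.mapsTo hzS)).trans h4.symm))

end Counting

/-! ### At t = 0 peeling counts placements -/

section Removal

variable {α β : Type*} [Fintype α] [DecidableEq α] [Fintype β] [LinearOrder β]
  {r : α → α → Prop} {a : α} {b : β}

open Classical in
/-- The weight `t` on the elements `r`-above `a`, and `1` elsewhere. -/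
noncomputable def softWeight (r : α → α → Prop) (a : α) (t : ℝ) (x : α) : ℝ :=
  if r a x then t else 1

open Classical in
omit [Fintype α] in
-- The zero weight above a restores the constraint lost by leaving a out of the peeled set.
theorem minWeight_softWeight_zero {S : Finset α} (ha : a ∈ S) (z : α) :
    minWeight r (softWeight r a 0) (S.erase a) z = if dn r S z = ∅ then 1 else 0 := by
  have h : dn r S z = ∅ ↔ dn r (S.erase a) z = ∅ ∧ ¬ r a z := by
    simp only [dn_eq_empty, Finset.mem_erase]
    constructor
    · exact fun h => ⟨fun x hx => h x hx.2, h a ha⟩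
    · rintro ⟨h1, h2⟩ x hx
      by_cases hxa : x = a
      · rwa [hxa]
      · exact h1 x ⟨hxa, hx⟩
  simp only [minWeight, softWeight, h, ite_and]
  split_ifs <;> rfl

/-- With no position left above b, peeling proceeds from the bottom: this is the recursion at the
top position for the reversed orders. -/
theorem removalCount_replicate_min (hra : ¬ r a a) (p : ℕ) (S : Finset α) (P : Finset β)
    (ha : a ∈ S) (hb : b ∈ P) (hq : #{c ∈ P | b < c} = 0) (hp : #{c ∈ P | c < b} = p) :
    removalCount r (softWeight r a 0) (softWeight (flip r) a 0) (List.replicate p (1, 0))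
      (S.erase a) = #(placements r (· < ·) a b S P) := by
  classical
  rw [Finset.card_eq_zero, Finset.filter_eq_empty_iff] at hq
  induction p generalizing S P with
  | zero =>
    rw [Finset.card_eq_zero, Finset.filter_eq_empty_iff] at hp
    have hP : P = {b} := Finset.eq_singleton_iff_unique_mem.2
      ⟨hb, fun c hc => le_antisymm (not_lt.1 (hq hc)) (not_lt.1 (hp hc))⟩
    rw [hP, card_placements_singleton ha hra]
    simp [removalCount]
  | succ p ih =>
    obtain ⟨m, hm, hmin⟩ : ∃ m ∈ P, ∀ c ∈ P, m ≤ c := Finset.exists_min_image P id ⟨b, hb⟩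
    have hmb : m < b := by
      obtain ⟨c, hc⟩ := Finset.card_pos.1 (by omega : 0 < #{c ∈ P | c < b})
      rw [Finset.mem_filter] at hc
      exact (hmin c hc.1).trans_lt hc.2
    rw [← placements_flip, card_placements (s := flip (· < ·)) (fun c d h h' => lt_asymm h h') hm hmb.ne
      (fun c hc hcm => lt_of_le_of_ne (hmin c hc) hcm.symm)]
    rw [List.replicate_succ, removalCount]
    refine Finset.sum_congr rfl fun z hz => ?_
    have hza := Finset.ne_of_mem_erase hz
    rw [Finset.erase_right_comm, ih (S.erase z) (P.erase m) (Finset.mem_erase.2 ⟨hza.symm, ha⟩)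
      (Finset.mem_erase.2 ⟨hmb.ne', hb⟩) (fun c hc => hq (Finset.mem_of_mem_erase hc)) ?_,
      placements_flip, extWeight, minWeight_softWeight_zero ha]
    · simp
    · rw [Finset.filter_erase, Finset.card_erase_of_mem (by simp [hm, hmb]), hp]
      rfl

theorem removalCount_replicate_max (hra : ¬ r a a) (q p : ℕ) (S : Finset α) (P : Finset β)
    (ha : a ∈ S) (hb : b ∈ P) (hq : #{c ∈ P | b < c} = q) (hp : #{c ∈ P | c < b} = p) :
    removalCount r (softWeight r a 0) (softWeight (flip r) a 0)
      (List.replicate q (0, 1) ++ List.replicate p (1, 0)) (S.erase a)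
      = #(placements r (· < ·) a b S P) := by
  classical
  induction q generalizing S P with
  | zero => exact removalCount_replicate_min hra p S P ha hb hq hp
  | succ q ih =>
    obtain ⟨m, hm, hmax⟩ : ∃ m ∈ P, ∀ c ∈ P, c ≤ m := Finset.exists_max_image P id ⟨b, hb⟩
    have hmb : b < m := by
      obtain ⟨c, hc⟩ := Finset.card_pos.1 (by omega : 0 < #{c ∈ P | b < c})
      rw [Finset.mem_filter] at hc
      exact hc.2.trans_le (hmax c hc.1)
    rw [card_placements (fun c d h h' => lt_asymm h h') hm hmb.ne'
      (fun c hc hcm => lt_of_le_of_ne (hmax c hc) hcm)]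
    rw [List.replicate_succ, List.cons_append, removalCount]
    refine Finset.sum_congr rfl fun z hz => ?_
    have hza := Finset.ne_of_mem_erase hz
    rw [Finset.erase_right_comm, ih (S.erase z) (P.erase m) (Finset.mem_erase.2 ⟨hza.symm, ha⟩)
      (Finset.mem_erase.2 ⟨hmb.ne, hb⟩) ?_ ?_, extWeight, minWeight_softWeight_zero (r := flip r) ha]
    · simp
    · rw [Finset.filter_erase, Finset.card_erase_of_mem (by simp [hm, hmb]), hq]
      rfl
    · rw [Finset.filter_erase, Finset.erase_eq_of_notMem (by simp [hmb.le]), hp]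

end Removal

/-! ### Linear extensions and the limit t → 0 -/

section LinearExtensions

/-- The list of weights which removes `q` maximal and then `p` minimal elements, perturbed by
`t`. -/
def removalList (q p : ℕ) (t : ℝ) : List (ℝ × ℝ) :=
  List.replicate q (t, 1) ++ List.replicate p (1, t)

theorem eLinExt_eq_removalCount {α : Type*} [Finite α] [DecidableEq α] [PartialOrder α] (a : α)
    {k : ℕ} (hk1 : 1 ≤ k) (hk2 : k ≤ Nat.card α) (S : Finset α) (hS : ∀ x, x ∈ S ↔ x ≠ a) :
    (eLinExt a k : ℝ) = removalCount (· < ·) (softWeight (· < ·) a 0)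
      (softWeight (flip (· < ·)) a 0) (removalList (Nat.card α - k) (k - 1) 0) S := by
  classical
  have := Fintype.ofFinite α
  let b : Set.Icc (1 : ℕ) (Nat.card α) := ⟨k, hk1, hk2⟩
  have hSe : S = (Finset.univ : Finset α).erase a := by
    ext x; simp [hS]
  have hq : #{c : Set.Icc (1 : ℕ) (Nat.card α) | b < c} = Nat.card α - k := by
    rw [← Nat.card_Ioc]
    refine Finset.card_bij (fun c _ => (c : ℕ)) ?_ (fun _ _ _ _ h => Subtype.ext h) ?_
    · intro c hc
      have h1 : k < (c : ℕ) := (Finset.mem_filter.1 hc).2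
      exact Finset.mem_Ioc.2 ⟨h1, c.2.2⟩
    · intro c hc
      rw [Finset.mem_Ioc] at hc
      exact ⟨⟨c, hk1.trans hc.1.le, hc.2⟩, Finset.mem_filter.2 ⟨Finset.mem_univ _, hc.1⟩, rfl⟩
  have hp : #{c : Set.Icc (1 : ℕ) (Nat.card α) | c < b} = k - 1 := by
    rw [← Nat.card_Ico]
    refine Finset.card_bij (fun c _ => (c : ℕ)) ?_ (fun _ _ _ _ h => Subtype.ext h) ?_
    · intro c hc
      have h1 : (c : ℕ) < k := (Finset.mem_filter.1 hc).2
      exact Finset.mem_Ico.2 ⟨c.2.1, h1⟩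
    · intro c hc
      rw [Finset.mem_Ico] at hc
      exact ⟨⟨c, hc.1, hc.2.le.trans hk2⟩, Finset.mem_filter.2 ⟨Finset.mem_univ _, hc.2⟩, rfl⟩
  rw [hSe, removalList, removalCount_replicate_max (lt_irrefl a) _ _ Finset.univ Finset.univ
    (Finset.mem_univ a) (Finset.mem_univ b) hq hp, eLinExt, Nat.cast_inj]
  let e : {f : LinExt α // (f.1 a : ℕ) = k} ≃
      {f // f ∈ placements (· < ·) (· < ·) a b Finset.univ Finset.univ} :=
    { toFun := fun f => ⟨f.1.1, mem_placements.2 ⟨by simp, by simp,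
        fun x _ y _ h => f.1.2 h, Subtype.ext f.2⟩⟩
      invFun := fun g => ⟨⟨Equiv.ofBijective g.1 (by simpa using (mem_placements.1 g.2).2.1),
        fun x y h => (mem_placements.1 g.2).2.2.1 x (Finset.mem_univ x) y (Finset.mem_univ y) h⟩,
        congrArg Subtype.val (mem_placements.1 g.2).2.2.2⟩
      left_inv := fun f => Subtype.ext (Subtype.ext (Equiv.ext fun _ => rfl))
      right_inv := fun g => rfl }
  rw [Nat.card_congr e, Nat.card_eq_fintype_card, Fintype.card_coe]
  rfl

theorem exists_dn_eq_empty {X : Type*} [PartialOrder X] (Y : Finset X) (hY : Y.Nonempty) :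
    ∃ x ∈ Y, dn (· < ·) Y x = ∅ := by
  obtain ⟨x, hx⟩ := Y.exists_minimal hY
  exact ⟨x, hx.prop, dn_eq_empty.2 fun y hy => hx.not_lt hy⟩

/-- For 0 < t < 1 all weights are positive and `removalCount_mul_le` applies; the counts are
continuous in t, so the inequality survives at 0. -/
theorem removalCount_limit_mul_le {X : Type*} [DecidableEq X] [PartialOrder X] (a : X) (q p : ℕ)
    {Y : Finset X} (hY : #Y = q + p + 2) {x y : X} (hx : x ∈ Y) (hy : y ∈ Y) (hxy : x ≠ y)
    (hex : IsExt (· < ·) Y x) (hey : IsExt (· < ·) Y y) :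
    let N := fun q => removalCount (· < ·) (softWeight (· < ·) a 0)
      (softWeight (flip (· < ·)) a 0) (removalList q p 0)
    N (q + 2) Y * N q ((Y.erase x).erase y) ≤ 2 * N (q + 1) (Y.erase x) * N (q + 1) (Y.erase y) := by
  intro N
  let M := fun (q : ℕ) (Z : Finset X) (t : ℝ) => removalCount (· < ·) (softWeight (· < ·) a t)
    (softWeight (flip (· < ·)) a t) (removalList q p t) Z
  have hsw : ∀ (r : X → X → Prop) x, Continuous fun t => softWeight r a t x := by
    intro r x
    unfold softWeight
    split_ifs
    exacts [continuous_id, continuous_const]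
  have hM : ∀ q Z, Continuous (M q Z) := by
    intro q Z
    have := continuous_removalCount (· < ·) (hsw (· < ·)) (hsw (flip (· < ·)))
      (List.replicate q (fun t : ℝ => (t, (1 : ℝ))) ++ List.replicate p fun t : ℝ => ((1 : ℝ), t))
      (by
        intro g hg
        rcases List.mem_append.1 hg with hg | hg <;> rw [List.eq_of_mem_replicate hg] <;> fun_prop)
      Z
    simpa [M, removalList] using this
  have hpos : ∀ (r : X → X → Prop) {t : ℝ}, 0 < t → ∀ x, 0 < softWeight r a t x := by
    intro r t ht x
    unfold softWeight
    split_ifs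
    exacts [ht, one_pos]
  have key : ∀ t ∈ Set.Ioo (0 : ℝ) 1, M (q + 2) Y t * M q ((Y.erase x).erase y) t
      ≤ 2 * M (q + 1) (Y.erase x) t * M (q + 1) (Y.erase y) t := by
    rintro t ⟨ht0, ht1⟩
    refine removalCount_mul_le (c := (t, 1)) (C := removalList q p t) exists_dn_eq_empty
      (hpos _ ht0) (hpos _ ht0) ?_ ⟨ht0, one_pos⟩ ?_ ?_ hx hy hxy hex hey
    -- The elements above a form an up-set and those below a a down-set; since t < 1, the first
    -- weight decreases and the second increases along the order.
    · intro u v huv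
      have h1 : softWeight (· < ·) a t v ≤ softWeight (· < ·) a t u := by
        unfold softWeight
        split_ifs with h1 h2 h2
        · exact le_rfl
        · exact ht1.le
        · exact absurd (h2.trans huv) h1
        · exact le_rfl
      have h2 : softWeight (flip (· < ·)) a t u ≤ softWeight (flip (· < ·)) a t v := by
        unfold softWeight
        split_ifs with h1 h2 h2
        · exact le_rfl
        · exact ht1.le
        · exact absurd (lt_trans huv h2) h1
        · exact le_rfl
      exact mul_le_mul h1 h2 (hpos _ ht0 u).le (hpos _ ht0 u).le
    · intro c hc
      rcases List.mem_append.1 hc with hc | hc <;> rw [List.eq_of_mem_replicate hc]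
      exacts [⟨ht0, one_pos⟩, ⟨one_pos, ht0⟩]
    · simp [removalList, hY]
  refine le_of_tendsto_of_tendsto (b := nhdsWithin (0 : ℝ) (Set.Ioi 0))
    (((hM _ _).mul (hM _ _)).tendsto' 0 _ rfl |>.mono_left nhdsWithin_le_nhds)
    ((((continuous_const (y := (2 : ℝ))).mul (hM _ _)).mul (hM _ _)).tendsto' 0 _ rfl
      |>.mono_left nhdsWithin_le_nhds) ?_
  filter_upwards [Ioo_mem_nhdsGT (zero_lt_one (α := ℝ))] with t ht using key t ht

theorem eLinExt_subtype_eq_removalCount {X : Type*} [Finite X] [DecidableEq X] [PartialOrder X]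
    {p : X → Prop} (a : X) (ha : p a) {k : ℕ} (hk1 : 1 ≤ k) (S : Finset X)
    (hS : ∀ x, x ∈ S ↔ p x ∧ x ≠ a) {q : ℕ} (hq : #S + 1 = q + k) :
    (eLinExt (⟨a, ha⟩ : {x // p x}) k : ℝ) = removalCount (· < ·) (softWeight (· < ·) a 0)
      (softWeight (flip (· < ·)) a 0) (removalList q (k - 1) 0) S := by
  classical
  have := Fintype.ofFinite X
  let T : Finset {x // p x} := Finset.univ.erase ⟨a, ha⟩
  have hT : T.map (Function.Embedding.subtype p) = S := by
    ext x
    simp [T, hS, and_comm]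
  have hcard : Nat.card {x // p x} = q + k := by
    have h1 : #T + 1 = Fintype.card {x // p x} :=
      Finset.card_erase_add_one (Finset.mem_univ _)
    rw [Nat.card_eq_fintype_card, ← h1, ← hq, ← hT, Finset.card_map]
  rw [eLinExt_eq_removalCount _ hk1 (by omega) T (by simp [T]), ← hT, removalCount_map, hcard,
    Nat.add_sub_cancel]
  congr 1

end LinearExtensions

theorem theoremt {X : Type*} [Finite X] [PartialOrder X] (n : ℕ) (hn : Nat.card X = n)
    (hn2 : 2 < n) (a : X) (k : ℕ) (hk1 : 1 ≤ k) (hk2 : k ≤ n - 2)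
    (x y : {z : X // z ≠ a}) (hxy : x ≠ y) (hx : IsMin x) (hy : IsMin y) :
    eLinExt a k *
        eLinExt (⟨a, x.2.symm, y.2.symm⟩ : {z : X // z ≠ (x : X) ∧ z ≠ (y : X)}) k ≤
      2 * eLinExt (⟨a, x.2.symm⟩ : {z : X // z ≠ (x : X)}) k *
        eLinExt (⟨a, y.2.symm⟩ : {z : X // z ≠ (y : X)}) k := by
  classical
  have := Fintype.ofFinite X
  have hxy' : (x : X) ≠ y := fun h => hxy (Subtype.ext h)
  set Y : Finset X := Finset.univ.erase a with hYdef
  have hxY : (x : X) ∈ Y := by simp [hYdef, x.2]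
  have hyY : (y : X) ∈ Y := by simp [hYdef, y.2]
  have hYcard : #Y = n - 1 := by
    rw [hYdef, Finset.card_erase_of_mem (Finset.mem_univ a), Finset.card_univ,
      ← Nat.card_eq_fintype_card, hn]
  have hmin : ∀ z : {z : X // z ≠ a}, IsMin z → IsExt (· < ·) Y z := by
    intro z hz
    refine Or.inl (dn_eq_empty.2 fun v hv hvz => ?_)
    exact hz.not_lt (b := ⟨v, Finset.ne_of_mem_erase hv⟩) hvz
  have h1 : #(Y.erase x) = n - 2 := by
    rw [Finset.card_erase_of_mem hxY, hYcard]; omega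
  have h2 : #(Y.erase y) = n - 2 := by
    rw [Finset.card_erase_of_mem hyY, hYcard]; omega
  have h3 : #((Y.erase x).erase y) = n - 3 := by
    rw [Finset.card_erase_of_mem (Finset.mem_erase.2 ⟨hxy'.symm, hyY⟩), h1]; omega
  have main := removalCount_limit_mul_le a (n - 2 - k) (k - 1) (Y := Y) (by omega) hxY hyY hxy'
    (hmin x hx) (hmin y hy)
  dsimp only at main
  have e0 := eLinExt_eq_removalCount a hk1 (by omega) Y (by simp [hYdef])
  -- Here k ≤ n - 2 is essential: the peeling of P must start with two maximal steps, because the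
  -- two outer steps have to carry the same weights.
  rw [hn, show n - k = n - 2 - k + 2 by omega] at e0
  have e1 := eLinExt_subtype_eq_removalCount (p := fun z => z ≠ (x : X)) a x.2.symm hk1
    (Y.erase x) (by simp [hYdef]) (q := n - 2 - k + 1) (by omega)
  have e2 := eLinExt_subtype_eq_removalCount (p := fun z => z ≠ (y : X)) a y.2.symm hk1
    (Y.erase y) (by simp [hYdef]) (q := n - 2 - k + 1) (by omega)
  have e3 := eLinExt_subtype_eq_removalCount (p := fun z => z ≠ (x : X) ∧ z ≠ (y : X)) a
    ⟨x.2.symm, y.2.symm⟩ hk1 ((Y.erase x).erase y) (by simp [hYdef]; tauto) (q := n - 2 - k)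
    (by omega)
  rw [← e0, ← e1, ← e2, ← e3] at main
  exact_mod_cast main
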